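/- Let $d\geqslant 2$ and let $T$ be a tiling of $\mathbb{R}^d$ by (possibly labelled) compact $d$-dimensional polyhedra which meet only on their boundaries, with finitely many tiles up to translation (tiles may, but need not, meet face to face). Suppose that $T$ is periodic, i.e. the group $\Lambda=\{w\in\mathbb{R}^d : T+w=T\}$ of its translational symmetries spans $\mathbb{R}^d$. A patch is a finite set of tiles, and the $r$-patch of $T$ at $x$ is the set of tiles of $T$ that meet the closed ball of radius $r$ about $x$. Let $G$ be the point group of $T$: a finite subgroup $G\leqslant \mathrm{SO}(d)$ such that for every patch $P$ of $T$ and every $g\in G$ a translate of $g(P)$ is a patch of $T$, and such that for some $r>0$ the following holds: if $g\in\mathrm{SO}(d)$ and a translate of $g(P)$ is a patch of $T$ for some $r$-patch $P$ of $T$, then $g\in G$. Let $\Omega_t$ be the translational hull of $T$: the space of all tilings each of whose patches is a translate of a patch of $T$, topologised so that two tilings are close if, after a small translation followed by a small rotation of one of them, they agree to a large radius about the origin. The group $G$ acts on $\Omega_t$ by $g\cdot T'=g(T')$. Let $EG$ be any contractible space with a free, properly discontinuous action of $G$, let $e_0\in EG$, and put $BG=EG/G$ and $\Omega_G=(\Omega_t\times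 EG)/G$ (quotient by the diagonal action). Let $\Gamma_+$ be the positive space group of $T$, i.e. the group of all orientation preserving isometries $\Phi$ of $\mathbb{R}^d$ with $\Phi(T)=T$. Then $\Lambda\cong\mathbb{Z}^d$. Inclusion of translations and passage to the linear part give a group extension (the standard extension) $$1\to\Lambda\to\Gamma_+\to G\to 1 .$$ The maps $\Omega_t\to\Omega_G$, $T'\mapsto[T',e_0]$, and $\Omega_G\to BG$, $[T',e]\mapsto[e]$, together with the canonical isomorphism $\pi_1(BG,[e_0])\cong G$ of the covering $EG\to BG$, induce a group extension $$1\to\pi_1(\Omega_t,T)\to\pi_1(\Omega_G,[T,e_0])\to G\to 1 .$$ These two extensions are isomorphic: there are isomorphisms $\pi_1(\Omega_t,T)\cong\Lambda$ and $\pi_1(\Omega_G,[T,e_0])\cong\Gamma_+$ which, together with the identity of $G$, form a commutative diagram between them. -/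

import Mathlib

noncomputable section

namespace RotTiling

universe u v

/-- Euclidean space `ℝ^d`. -/
abbrev Euc (d : ℕ) : Type := EuclideanSpace ℝ (Fin d)

/-- The group of all isometries of `ℝ^d`. -/
abbrev Isom (d : ℕ) : Type := Euc d ≃ᵃⁱ[ℝ] Euc d

/-- Translation `x ↦ v + x`. -/
abbrev transl {d : ℕ} (w : Euc d) : Isom d := AffineIsometryEquiv.constVAdd ℝ (Euc d) w

/-- A linear isometry, regarded as an isometry of `ℝ^d` fixing the origin. -/
abbrev rot {d : ℕ} (g : Euc d ≃ₗᵢ[ℝ] Euc d) : Isom d := g.toAffineIsometryEquiv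

/-- The homomorphism sending an isometry of `ℝ^d` to its linear part. -/
def linearPart (d : ℕ) : Isom d →* (Euc d ≃ₗᵢ[ℝ] Euc d) where
  toFun Φ := Φ.linearIsometryEquiv
  map_one' := rfl
  map_mul' _ _ := rfl

/-- The rotation group `SO(d)`, as a subgroup of the orthogonal group. -/
def SO (d : ℕ) : Subgroup (Euc d ≃ₗᵢ[ℝ] Euc d) where
  carrier := {g | LinearMap.det (g.toLinearEquiv : Euc d →ₗ[ℝ] Euc d) = 1}
  one_mem' := LinearMap.det_id
  mul_mem' := by
    intro a b ha hb
    have h := LinearMap.det_comp (a.toLinearEquiv : Euc d →ₗ[ℝ] Euc d)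
      (b.toLinearEquiv : Euc d →ₗ[ℝ] Euc d)
    rw [Set.mem_ofPred_eq] at ha hb
    rw [ha, hb, mul_one] at h
    exact h
  inv_mem' := by
    intro a ha
    rw [Set.mem_ofPred_eq] at ha
    have h := a.toLinearEquiv.det_symm_mul_det
    rw [ha, mul_one] at h
    exact h

/-! ### Tilings -/

/-- A compact `d`-dimensional polyhedral subset of `ℝ^d`: a non-empty finite union of convex
polytopes with non-empty interior. It need not be convex. -/
def IsPolyhedron {d : ℕ} (P : Set (Euc d)) : Prop :=
  ∃ F : Set (Set (Euc d)), F.Finite ∧ F.Nonempty ∧ P = ⋃₀ F ∧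
    ∀ C ∈ F, (∃ V : Finset (Euc d), C = convexHull ℝ (V : Set (Euc d))) ∧ (interior C).Nonempty

/-- A labelled subset of `ℝ^d`. -/
structure Tile (d : ℕ) (L : Type u) where
  /-- the label, or colour -/
  label : L
  /-- the underlying set of points -/
  carrier : Set (Euc d)

variable {d : ℕ} {L : Type u}

/-- The image of a tile under an isometry, which preserves the label. -/
def Tile.move (Φ : Isom d) (t : Tile d L) : Tile d L := ⟨t.label, Φ '' t.carrier⟩

/-- The image `Φ(P)` of a collection of tiles. -/
def move (Φ : Isom d) (P : Set (Tile d L)) : Set (Tile d L) := Tile.move Φ '' P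

/-- Tilings of `ℝ^d` by labelled compact `d`-dimensional polyhedra which meet only on their
boundaries, with finitely many tiles up to translation. No condition on how the boundaries
of neighbouring tiles fit together is imposed, so face-to-face tilings are included. -/
structure IsTiling (T : Set (Tile d L)) : Prop where
  polyhedral : ∀ t ∈ T, IsPolyhedron t.carrier
  cover : ∀ x : Euc d, ∃ t ∈ T, x ∈ t.carrier
  disjoint : ∀ s ∈ T, ∀ t ∈ T, s ≠ t → Disjoint (interior s.carrier) (interior t.carrier)
  prototiles : ∃ Q : Set (Tile d L), Q.Finite ∧
    ∀ t ∈ T, ∃ q ∈ Q, ∃ w : Euc d, t = Tile.move (transl w) q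

/-- The `r`-patch of `T` centred at `x`. -/
def ballPatch (T : Set (Tile d L)) (x : Euc d) (r : ℝ) : Set (Tile d L) :=
  {t ∈ T | (t.carrier ∩ Metric.closedBall x r).Nonempty}

/-- The collection `P` of tiles appears in `T`, up to translation. -/
def AppearsIn (P T : Set (Tile d L)) : Prop := ∃ w : Euc d, move (transl w) P ⊆ T

/-- Every patch (finite set of tiles) of `T'` appears in `T`, up to translation. -/
def LocallyIndistinguishable (T T' : Set (Tile d L)) : Prop :=
  ∀ P ⊆ T', P.Finite → AppearsIn P T

/-! ### The translational hull -/

/-- The translational hull `Ω_t` of `T`. -/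
def Hull (T : Set (Tile d L)) : Type u :=
  {T' : Set (Tile d L) // IsTiling T' ∧ LocallyIndistinguishable T T'}

/-- `T₁` and `T₂` agree within distance `1/ε` of the origin, after applying to `T₁` a translation
and then a rotation, both of size less than `ε`. -/
def IsClose (ε : ℝ) (T₁ T₂ : Set (Tile d L)) : Prop :=
  ∃ w : Euc d, ∃ g ∈ SO d, ‖w‖ < ε ∧
    ‖(g.toContinuousLinearEquiv : Euc d →L[ℝ] Euc d) - ContinuousLinearMap.id ℝ (Euc d)‖ < ε ∧
    ballPatch (move (rot g) (move (transl w) T₁)) 0 ε⁻¹ = ballPatch T₂ 0 ε⁻¹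

/-- The relation `IsClose ε` gets stronger as `ε` decreases. -/
theorem IsClose.mono {δ ε : ℝ} (hδ : 0 < δ) (h : δ ≤ ε) {T₁ T₂ : Set (Tile d L)}
    (hc : IsClose δ T₁ T₂) : IsClose ε T₁ T₂ := by
  obtain ⟨w, g, hg, hw, hn, hp⟩ := hc
  refine ⟨w, g, hg, hw.trans_le h, hn.trans_le h, ?_⟩
  have hb : Metric.closedBall (0 : Euc d) ε⁻¹ ⊆ Metric.closedBall 0 δ⁻¹ :=
    Metric.closedBall_subset_closedBall (inv_anti₀ hδ h)
  ext t
  constructor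
  · rintro ⟨ht, hx⟩
    have h1 : t ∈ ballPatch T₂ 0 δ⁻¹ := hp ▸ ⟨ht, hx.mono (Set.inter_subset_inter_right _ hb)⟩
    exact ⟨h1.1, hx⟩
  · rintro ⟨ht, hx⟩
    have h1 : t ∈ ballPatch (move (rot g) (move (transl w) T₁)) 0 δ⁻¹ :=
      hp ▸ ⟨ht, hx.mono (Set.inter_subset_inter_right _ hb)⟩
    exact ⟨h1.1, hx⟩

/-- The topology of the hull: a set is open if with each `T₁` it contains all tilings of the hull
that are sufficiently close to `T₁`. -/
instance (T : Set (Tile d L)) : TopologicalSpace (Hull T) where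
  IsOpen U := ∀ T₁ ∈ U, ∃ ε > 0, ∀ T₂ : Hull T, IsClose ε T₁.1 T₂.1 → T₂ ∈ U
  isOpen_univ _ _ := ⟨1, one_pos, fun _ _ => Set.mem_univ _⟩
  isOpen_inter := by
    intro U V hU hV T₁ hT₁
    obtain ⟨ε, hε, h⟩ := hU T₁ hT₁.1
    obtain ⟨δ, hδ, k⟩ := hV T₁ hT₁.2
    have hm : 0 < min ε δ := lt_min hε hδ
    exact ⟨min ε δ, hm, fun T₂ hc =>
      ⟨h T₂ (hc.mono hm (min_le_left _ _)), k T₂ (hc.mono hm (min_le_right _ _))⟩⟩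
  isOpen_sUnion := by
    intro S hS T₁ hT₁
    obtain ⟨U, hU, hTU⟩ := hT₁
    obtain ⟨ε, hε, h⟩ := hS U hU T₁ hTU
    exact ⟨ε, hε, fun T₂ hc => ⟨U, hU, h T₂ hc⟩⟩

theorem Tile.move_one (t : Tile d L) : t.move 1 = t := by
  cases t
  simp [Tile.move]

theorem Tile.move_mul (Φ Ψ : Isom d) (t : Tile d L) :
    t.move (Φ * Ψ) = (t.move Ψ).move Φ := by
  simp [Tile.move, Set.image_image]

theorem move_one (P : Set (Tile d L)) : move 1 P = P := by
  simp [move, Tile.move_one]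

theorem move_mul (Φ Ψ : Isom d) (P : Set (Tile d L)) :
    move (Φ * Ψ) P = move Φ (move Ψ P) := by
  simp [move, Set.image_image, Tile.move_mul]

theorem transl_add (v w : Euc d) : transl (v + w) = transl v * transl w := by
  ext x
  simp [add_assoc]

theorem transl_zero : transl (0 : Euc d) = 1 := by
  ext x
  simp

/-- A tiling, as the base point of its own hull. -/
def Hull.base {T : Set (Tile d L)} (hT : IsTiling T) : Hull T :=
  ⟨T, hT, fun P hP _ => ⟨0, by rwa [transl_zero, move_one]⟩⟩

/-! ### Point groups, space groups, periodicity -/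

/-- The group `G` acts on `T` by rotations: it is a finite subgroup of `SO(d)` and the image under
each `g ∈ G` of each patch of `T` is again a patch of `T`, up to translation. -/
structure ActsByRotations (T : Set (Tile d L)) (G : Subgroup (Euc d ≃ₗᵢ[ℝ] Euc d)) : Prop where
  finite : Finite G
  le_SO : G ≤ SO d
  appears : ∀ g ∈ G, ∀ P ⊆ T, P.Finite → AppearsIn (move (rot g) P) T

/-- The tiling `T` has point group `G`. -/
structure HasPointGroup (T : Set (Tile d L)) (G : Subgroup (Euc d ≃ₗᵢ[ℝ] Euc d)) : Prop where
  acts : ActsByRotations T G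
  maximal : ∃ r > 0, ∀ x : Euc d, ∀ g ∈ SO d,
    AppearsIn (move (rot g) (ballPatch T x r)) T → g ∈ G

/-- The group of translational symmetries of `T`, as a group of vectors. -/
def translations (T : Set (Tile d L)) : AddSubgroup (Euc d) where
  carrier := {w | move (transl w) T = T}
  zero_mem' := by rw [Set.mem_ofPred_eq, transl_zero, move_one]
  add_mem' := by
    intro v w hv hw
    rw [Set.mem_ofPred_eq] at hv hw ⊢
    rw [transl_add, move_mul, hw, hv]
  neg_mem' := by
    intro v hv
    rw [Set.mem_ofPred_eq] at hv ⊢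
    conv_lhs => rw [← hv]
    rw [← move_mul, ← transl_add, neg_add_cancel, transl_zero, move_one]

/-- `T` is periodic: its translational symmetries span `ℝ^d`. -/
def IsPeriodic (T : Set (Tile d L)) : Prop :=
  Submodule.span ℝ (translations T : Set (Euc d)) = ⊤

/-- The positive space group `Γ₊`: the group of orientation preserving symmetries of `T`. -/
def posSpaceGroup (T : Set (Tile d L)) : Subgroup (Isom d) where
  carrier := {Φ | linearPart d Φ ∈ SO d ∧ move Φ T = T}
  one_mem' := ⟨by rw [map_one]; exact one_mem _, move_one T⟩
  mul_mem' := by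
    rintro Φ Ψ ⟨h1, h2⟩ ⟨k1, k2⟩
    exact ⟨by rw [map_mul]; exact mul_mem h1 k1, by rw [move_mul, k2, h2]⟩
  inv_mem' := by
    rintro Φ ⟨h1, h2⟩
    refine ⟨by rw [map_inv]; exact inv_mem h1, ?_⟩
    conv_lhs => rw [← h2]
    rw [← move_mul, inv_mul_cancel, move_one]

/-! ### The Borel construction -/

/-- `X` is a model of `EG`: a contractible space with a free and properly discontinuous action
of the discrete group `G` (for finite `G` and Hausdorff `X`, any free action is of this kind). -/
structure IsUniversalSpace (G : Type u) (X : Type v) [Group G] [TopologicalSpace X]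
    [MulAction G X] : Prop where
  contractible : ContractibleSpace X
  continuous_smul : ∀ g : G, Continuous fun x : X => g • x
  free : ∀ x : X, ∃ U ∈ nhds x, ∀ g : G, ((fun y => g • y) '' U ∩ U).Nonempty → g = 1

/-- The classifying space `BG = EG/G`. -/
abbrev ClassifyingSpace (G : Type u) (EG : Type v) [Group G] [MulAction G EG] : Type v :=
  MulAction.orbitRel.Quotient G EG

/-- The class of a point of `EG` in `BG`. -/
abbrev ClassifyingSpace.mk (G : Type u) {EG : Type v} [Group G] [MulAction G EG] (e : EG) :
    ClassifyingSpace G EG :=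
  Quotient.mk (MulAction.orbitRel G EG) e

section Borel

variable {T : Set (Tile d L)} {G : Subgroup (Euc d ≃ₗᵢ[ℝ] Euc d)}
variable {EG : Type v} [MulAction G EG]

/-- The orbit relation of the diagonal action `g • (T', e) = (g(T'), g • e)` on `Ω_t × EG`. -/
def borelSetoid (T : Set (Tile d L)) (G : Subgroup (Euc d ≃ₗᵢ[ℝ] Euc d)) (EG : Type v)
    [MulAction G EG] : Setoid (Hull T × EG) where
  r a b := ∃ g : G, move (rot g.1) a.1.1 = b.1.1 ∧ g • a.2 = b.2
  iseqv :=
    { refl := fun a => ⟨1, move_one _, one_smul _ _⟩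
      symm := by
        rintro a b ⟨g, h, k⟩
        refine ⟨g⁻¹, ?_, by rw [← k, inv_smul_smul]⟩
        rw [← h, ← move_mul]
        have : rot (g⁻¹ : G).1 * rot g.1 = 1 := by
          ext x
          simp [AffineIsometryEquiv.coe_mul]
        rw [this, move_one]
      trans := by
        rintro a b c ⟨g, h, k⟩ ⟨g', h', k'⟩
        refine ⟨g' * g, ?_, by rw [mul_smul, k, k']⟩
        have : rot (g' * g : G).1 = rot g'.1 * rot g.1 := rfl
        rw [this, move_mul, h, h'] }

/-- The space `Ω_G = (Ω_t × EG)/G`, for a given model of `EG`. -/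
abbrev BorelHull (T : Set (Tile d L)) (G : Subgroup (Euc d ≃ₗᵢ[ℝ] Euc d)) (EG : Type v)
    [MulAction G EG] : Type (max u v) :=
  Quotient (borelSetoid T G EG)

variable [TopologicalSpace EG]

/-- The inclusion of the fibre `Ω_t → Ω_G`, `T' ↦ [T', e₀]`. -/
def fibreInclusion (T : Set (Tile d L)) (G : Subgroup (Euc d ≃ₗᵢ[ℝ] Euc d)) {EG : Type v}
    [MulAction G EG] [TopologicalSpace EG] (e₀ : EG) : C(Hull T, BorelHull T G EG) where
  toFun T' := Quotient.mk _ (T', e₀)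
  continuous_toFun := continuous_quotient_mk'.comp (by fun_prop)

/-- The projection `Ω_G → BG`, `[T', e] ↦ [e]`. -/
def borelProjection (T : Set (Tile d L)) (G : Subgroup (Euc d ≃ₗᵢ[ℝ] Euc d)) (EG : Type v)
    [MulAction G EG] [TopologicalSpace EG] : C(BorelHull T G EG, ClassifyingSpace G EG) where
  toFun := Quotient.lift (fun a => ClassifyingSpace.mk G a.2) (by
    rintro a b ⟨g, _, k⟩
    exact (Quotient.sound ⟨g, k⟩ : ClassifyingSpace.mk G b.2 = ClassifyingSpace.mk G a.2).symm)
  continuous_toFun := Continuous.quotient_lift (continuous_quotient_mk'.comp continuous_snd) _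

/-- The homomorphism `π₁(Ω_t, T) → π₁(Ω_G, [T, e₀])` induced by the inclusion of the fibre. -/
def piInclusion (hT : IsTiling T) (G : Subgroup (Euc d ≃ₗᵢ[ℝ] Euc d)) {EG : Type v}
    [MulAction G EG] [TopologicalSpace EG] (e₀ : EG) :
    FundamentalGroup (Hull T) (Hull.base hT) →*
      FundamentalGroup (BorelHull T G EG) (fibreInclusion T G e₀ (Hull.base hT)) :=
  FundamentalGroup.map (fibreInclusion T G e₀) (Hull.base hT)

/-- The homomorphism `π₁(Ω_G, [T, e₀]) → π₁(BG, [e₀])` induced by the projection. -/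
def piProjection (hT : IsTiling T) (G : Subgroup (Euc d ≃ₗᵢ[ℝ] Euc d)) {EG : Type v}
    [MulAction G EG] [TopologicalSpace EG] (e₀ : EG) :
    FundamentalGroup (BorelHull T G EG) (fibreInclusion T G e₀ (Hull.base hT)) →*
      FundamentalGroup (ClassifyingSpace G EG) (ClassifyingSpace.mk G e₀) :=
  FundamentalGroup.map (borelProjection T G EG) (fibreInclusion T G e₀ (Hull.base hT))

end Borel

/-- The quotient map `EG → BG` is a principal `G`-covering. -/
theorem IsUniversalSpace.covering {G : Type u} {EG : Type v} [Group G] [TopologicalSpace EG]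
    [MulAction G EG] (h : IsUniversalSpace G EG) :
    IsQuotientCoveringMap (ClassifyingSpace.mk G : EG → ClassifyingSpace G EG) G where
  toIsQuotientMap := isQuotientMap_quotient_mk'
  continuous_const_smul := h.continuous_smul
  apply_eq_iff_mem_orbit := Quotient.eq
  disjoint := h.free

/-- The canonical isomorphism `π₁(BG, [e₀]) ≅ G` given by the covering `EG → BG`. A loop whose lift
starting at `e₀` ends at `g • e₀` is sent to `g⁻¹`; the inverse is there because in Mathlib's
fundamental group the product `p * q` runs first through `q` and then through `p`. -/
def piClassifyingSpace {G : Type u} {EG : Type v} [Group G] [TopologicalSpace EG]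
    [MulAction G EG] (h : IsUniversalSpace G EG) (e₀ : EG) :
    FundamentalGroup (ClassifyingSpace G EG) (ClassifyingSpace.mk G e₀) ≃* G :=
  haveI := h.contractible
  (h.covering.fundamentalGroupEquiv ⟨e₀, rfl⟩).trans (MulEquiv.inv' G).symm

end RotTiling

end

open RotTiling

noncomputable section

namespace RotTiling

universe u v

variable {d : ℕ} {L : Type u}

/-! ### Polyhedra -/

/-! Periodicity makes the hull a torus. Every tiling in `Ω_t` is a translate of `T`
(`Hull.translate_surjective`), so `w ↦ T - w` maps `ℝ^d` onto `Ω_t`, and its fibres are the cosets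
of `Λ`. The topology of `Ω_t`, although it allows small rotations, is the quotient topology
(`HasPointGroup.eventually_isClose`): at a small scale a rotation relating two tilings of the hull
must lie in the finite group `G`, hence is trivial, and agreement on a ball meeting every coset of
`Λ` forces equality everywhere. Thus `ℝ^d → Ω_t` is a covering with deck group `Λ`.

In the same way `(w, e) ↦ [T - w, e]` is a covering of `Ω_G` by `ℝ^d × EG` with deck group `Γ₊`,
which acts by isometries on `ℝ^d` and through its linear part on `EG`. All the total spaces are
contractible, so `π₁` of each base is its deck group. The maps `w ↦ (w, e₀)` and `(w, e) ↦ e` are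
equivariant and cover `Ω_t → Ω_G → BG`; naturality of the deck group isomorphism (`deckEquiv_map`)
gives the commutative diagram, and exactness of the topological row is inherited from the standard
extension. -/

theorem interior_image_isom (Φ : Isom d) (C : Set (Euc d)) :
    interior (Φ '' C) = Φ '' interior C :=
  (Φ.toHomeomorph.image_interior C).symm

theorem IsPolyhedron.isCompact {P : Set (Euc d)} (h : IsPolyhedron P) : IsCompact P := by
  obtain ⟨F, hF, -, rfl, hC⟩ := h
  refine hF.isCompact_sUnion fun C hCF => ?_
  obtain ⟨⟨V, rfl⟩, -⟩ := hC C hCF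
  exact V.finite_toSet.isCompact_convexHull ℝ

theorem IsPolyhedron.interior_nonempty {P : Set (Euc d)} (h : IsPolyhedron P) :
    (interior P).Nonempty := by
  obtain ⟨F, -, ⟨C, hCF⟩, rfl, hC⟩ := h
  exact (hC C hCF).2.mono (interior_mono (Set.subset_sUnion_of_mem hCF))

theorem IsPolyhedron.subset_closure_interior {P : Set (Euc d)} (h : IsPolyhedron P) :
    P ⊆ closure (interior P) := by
  obtain ⟨F, -, -, rfl, hC⟩ := h
  refine Set.sUnion_subset fun C hCF => ?_
  obtain ⟨⟨V, hV⟩, hi⟩ := hC C hCF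
  have hconv : Convex ℝ C := hV ▸ convex_convexHull ℝ _
  calc C ⊆ closure C := subset_closure
    _ = closure (interior C) := (hconv.closure_interior_eq_closure_of_nonempty_interior hi).symm
    _ ⊆ _ := closure_mono (interior_mono (Set.subset_sUnion_of_mem hCF))

theorem IsPolyhedron.image {P : Set (Euc d)} (h : IsPolyhedron P) (Φ : Isom d) :
    IsPolyhedron (Φ '' P) := by
  classical
  obtain ⟨F, hF, hne, rfl, hC⟩ := h
  refine ⟨(fun C => Φ '' C) '' F, hF.image _, hne.image _, ?_, ?_⟩
  · rw [Set.image_sUnion]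
  · rintro _ ⟨C, hCF, rfl⟩
    obtain ⟨⟨V, rfl⟩, hi⟩ := hC C hCF
    refine ⟨⟨V.image Φ, ?_⟩, ?_⟩
    · rw [Finset.coe_image]
      exact Φ.toAffineEquiv.toAffineMap.image_convexHull (V : Set (Euc d))
    · dsimp only
      rw [interior_image_isom]
      exact hi.image _

/-! ### Moving tiles and tilings -/

@[simp]
theorem Tile.move_carrier (Φ : Isom d) (t : Tile d L) : (t.move Φ).carrier = Φ '' t.carrier := rfl

theorem move_mono (Φ : Isom d) {P Q : Set (Tile d L)} (h : P ⊆ Q) : move Φ P ⊆ move Φ Q :=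
  Set.image_mono h

theorem move_inv_move (Φ : Isom d) (P : Set (Tile d L)) : move Φ⁻¹ (move Φ P) = P := by
  rw [← move_mul, inv_mul_cancel, move_one]

theorem move_move_inv (Φ : Isom d) (P : Set (Tile d L)) : move Φ (move Φ⁻¹ P) = P := by
  rw [← move_mul, mul_inv_cancel, move_one]

theorem transl_neg (w : Euc d) : transl (-w) = (transl w)⁻¹ := by
  rw [eq_inv_iff_mul_eq_one, ← transl_add, neg_add_cancel, transl_zero]

theorem isom_mul_transl (Φ : Isom d) (w : Euc d) :
    Φ * transl w = transl (linearPart d Φ w) * Φ := by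
  ext1 x
  exact Φ.map_vadd x w

theorem isom_eq_transl_mul_rot (Φ : Isom d) : Φ = transl (Φ 0) * rot (linearPart d Φ) := by
  ext1 x
  have := Φ.map_vadd 0 x
  simp only [vadd_eq_add, add_zero] at this
  rw [this, add_comm]
  rfl

theorem linearPart_transl (w : Euc d) : linearPart d (transl w) = 1 := by
  ext x
  rfl

theorem linearPart_rot (g : Euc d ≃ₗᵢ[ℝ] Euc d) : linearPart d (rot g) = g := by
  ext x
  rfl

theorem IsTiling.move {T : Set (Tile d L)} (hT : IsTiling T) (Φ : Isom d) :
    IsTiling (move Φ T) where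
  polyhedral := by
    rintro _ ⟨t, ht, rfl⟩
    exact (hT.polyhedral t ht).image Φ
  cover x := by
    obtain ⟨t, ht, hx⟩ := hT.cover (Φ.symm x)
    exact ⟨_, ⟨t, ht, rfl⟩, _, hx, Φ.apply_symm_apply x⟩
  disjoint := by
    rintro _ ⟨s, hs, rfl⟩ _ ⟨t, ht, rfl⟩ hne
    simp only [Tile.move_carrier, interior_image_isom]
    exact (Set.disjoint_image_iff Φ.injective).2
      (hT.disjoint s hs t ht fun h => hne (by rw [h]))
  prototiles := by
    obtain ⟨Q, hQ, h⟩ := hT.prototiles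
    refine ⟨RotTiling.move Φ Q, hQ.image _, ?_⟩
    rintro _ ⟨t, ht, rfl⟩
    obtain ⟨q, hq, w, rfl⟩ := h t ht
    refine ⟨_, ⟨q, hq, rfl⟩, linearPart d Φ w, ?_⟩
    rw [← Tile.move_mul, ← Tile.move_mul, isom_mul_transl]

theorem IsTiling.eq_of_mem_interior {T : Set (Tile d L)} (hT : IsTiling T) {s t : Tile d L}
    (hs : s ∈ T) (ht : t ∈ T) {x : Euc d} (hxs : x ∈ interior s.carrier)
    (hxt : x ∈ interior t.carrier) : s = t := by
  by_contra hne
  exact Set.disjoint_left.1 (hT.disjoint s hs t ht hne) hxs hxt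

/-- A tiling contained in another tiling is equal to it. -/
theorem IsTiling.eq_of_subset {T₁ T₂ : Set (Tile d L)} (h₁ : IsTiling T₁) (h₂ : IsTiling T₂)
    (h : T₁ ⊆ T₂) : T₁ = T₂ := by
  refine h.antisymm fun t ht => ?_
  obtain ⟨x, hx⟩ := (h₂.polyhedral t ht).interior_nonempty
  obtain ⟨s, hs, hxs⟩ := h₁.cover x
  -- `x` is a limit of interior points of `s`, so the interiors of `s` and `t` overlap.
  obtain ⟨y, hyt, hys⟩ := mem_closure_iff.1
    ((h₁.polyhedral s hs).subset_closure_interior hxs) _ isOpen_interior hx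
  rwa [h₂.eq_of_mem_interior ht (h hs) hyt hys]

/-- Translation by `w` raises the maximum of `⟨w, ·⟩` on a compact set by `‖w‖²`. -/
theorem Tile.eq_zero_of_move_transl_eq {t : Tile d L} (ht : IsPolyhedron t.carrier) {w : Euc d}
    (h : t.move (transl w) = t) : w = 0 := by
  obtain ⟨x, hx, hmax⟩ := ht.isCompact.exists_isMaxOn
    (ht.interior_nonempty.mono interior_subset) (f := fun x => inner ℝ w x) (by fun_prop)
  have hwx : w + x ∈ t.carrier := by
    rw [← congrArg Tile.carrier h]
    exact ⟨x, hx, rfl⟩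
  have h1 : inner ℝ w (w + x) ≤ inner ℝ w x := hmax hwx
  rw [inner_add_right] at h1
  rw [real_inner_self_eq_norm_sq] at h1
  exact norm_eq_zero.1 (pow_eq_zero_iff two_ne_zero |>.1 (by nlinarith [sq_nonneg ‖w‖]))

/-- The translates of a given polyhedral tile which belong to a tiling are uniformly separated. -/
theorem IsTiling.exists_separation {T : Set (Tile d L)} (hT : IsTiling T) {t : Tile d L}
    (ht : IsPolyhedron t.carrier) : ∃ δ > 0, ∀ v w : Euc d, t.move (transl v) ∈ T →
      t.move (transl w) ∈ T → ‖v - w‖ < δ → v = w := by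
  obtain ⟨x, hx⟩ := ht.interior_nonempty
  obtain ⟨δ, hδ, hball⟩ := Metric.isOpen_iff.1 isOpen_interior x hx
  -- `δ` is the radius of a ball inside the tile: translates by vectors closer than `δ` have
  -- overlapping interiors, so they are the same tile.
  refine ⟨δ, hδ, fun v w hv hw hvw => ?_⟩
  have h := hT.eq_of_mem_interior hv hw (x := v + x)
    (by rw [Tile.move_carrier, interior_image_isom]; exact ⟨x, hx, rfl⟩)
    (by
      rw [Tile.move_carrier, interior_image_isom]
      refine ⟨v - w + x, hball ?_, ?_⟩
      · simpa [Metric.mem_ball, dist_eq_norm] using hvw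
      · change w + (v - w + x) = v + x
        abel)
  have h' : t.move (transl (v - w)) = t := by
    rw [sub_eq_neg_add, transl_add, Tile.move_mul, h, ← Tile.move_mul, ← transl_add,
      neg_add_cancel, transl_zero, Tile.move_one]
  exact sub_eq_zero.1 (Tile.eq_zero_of_move_transl_eq ht h')

/-! ### The lattice of translational symmetries -/

theorem IsTiling.nonempty {T : Set (Tile d L)} (hT : IsTiling T) : T.Nonempty :=
  let ⟨t, ht, _⟩ := hT.cover 0
  ⟨t, ht⟩

theorem mem_translations {T : Set (Tile d L)} {w : Euc d} :
    w ∈ translations T ↔ move (transl w) T = T := Iff.rfl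

theorem IsTiling.exists_pos_le_norm {T : Set (Tile d L)} (hT : IsTiling T) :
    ∃ δ > 0, ∀ w ∈ translations T, ‖w‖ < δ → w = 0 := by
  obtain ⟨t, ht⟩ := hT.nonempty
  obtain ⟨δ, hδ, h⟩ := hT.exists_separation (hT.polyhedral t ht)
  refine ⟨δ, hδ, fun w hw hwδ => h w 0 ?_ ?_ (by simpa using hwδ)⟩
  · rw [← mem_translations.1 hw]
    exact ⟨t, ht, rfl⟩
  · rwa [transl_zero, Tile.move_one]

theorem IsTiling.discreteTopology_translations {T : Set (Tile d L)} (hT : IsTiling T) :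
    DiscreteTopology (translations T) := by
  obtain ⟨δ, hδ, h⟩ := hT.exists_pos_le_norm
  refine discreteTopology_of_isOpen_singleton_zero (Metric.isOpen_singleton_iff.2 ⟨δ, hδ, ?_⟩)
  intro y hy
  exact Subtype.ext (h y y.2 (by simpa [dist_eq_norm] using hy))

theorem nonempty_translations_addEquiv {T : Set (Tile d L)} (hT : IsTiling T)
    (hper : IsPeriodic T) : Nonempty (translations T ≃+ (Fin d → ℤ)) := by
  let Λ : Submodule ℤ (Euc d) := (translations T).toIntSubmodule
  have : DiscreteTopology Λ := hT.discreteTopology_translations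
  have : IsZLattice ℝ Λ := ⟨hper⟩
  have hrank : Module.finrank ℤ Λ = Module.finrank ℤ (Fin d → ℤ) := by
    rw [ZLattice.rank ℝ Λ, finrank_euclideanSpace_fin, Module.finrank_fin_fun]
  exact ⟨(LinearEquiv.ofFinrankEq Λ (Fin d → ℤ) hrank).toAddEquiv⟩

/-- Cocompactness of `Λ`: it contains a basis of `ℝ^d`, and rounding coordinates down in that basis
leaves a bounded remainder. -/
theorem IsPeriodic.exists_norm_sub_le {T : Set (Tile d L)} (hper : IsPeriodic T) :
    ∃ R : ℝ, ∀ x : Euc d, ∃ w ∈ translations T, ‖x - w‖ ≤ R := by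
  let b := Module.Basis.ofSpan hper.ge
  have := FiniteDimensional.fintypeBasisIndex b
  refine ⟨∑ i, ‖b i‖, fun x => ⟨ZSpan.floor b x, ?_, ZSpan.norm_fract_le b x⟩⟩
  have hle : Submodule.span ℤ (Set.range b) ≤ (translations T).toIntSubmodule :=
    Submodule.span_le.2 (Module.Basis.ofSpan_subset hper.ge)
  exact hle (ZSpan.floor b x).2

open Filter Topology

/-! ### The hull of a periodic tiling -/

theorem IsTiling.finite_translates {T : Set (Tile d L)} (hT : IsTiling T) {t : Tile d L}
    (ht : IsPolyhedron t.carrier) (R : ℝ) :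
    {w : Euc d | t.move (transl w) ∈ T ∧ ‖w‖ ≤ R}.Finite := by
  obtain ⟨δ, hδ, h⟩ := hT.exists_separation ht
  obtain ⟨c, hc, hcov⟩ := Metric.totallyBounded_iff.1
    (isCompact_closedBall (0 : Euc d) R).totallyBounded (δ / 2) (half_pos hδ)
  refine (hc.biUnion (t := fun y => {w : Euc d | t.move (transl w) ∈ T} ∩ Metric.ball y (δ / 2))
    fun y _ => Set.Subsingleton.finite ?_).subset ?_
  · rintro v ⟨hv, hvy⟩ w ⟨hw, hwy⟩
    refine h v w hv hw ?_
    rw [← dist_eq_norm]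
    linarith [dist_triangle_right v w y, Metric.mem_ball.1 hvy, Metric.mem_ball.1 hwy]
  · rintro w ⟨hw, hwR⟩
    obtain ⟨y, hy, hwy⟩ := Set.mem_iUnion₂.1 (hcov (mem_closedBall_zero_iff.2 hwR))
    exact Set.mem_iUnion₂.2 ⟨y, hy, hw, hwy⟩

/-- The point `T - w` of the hull of `T`. -/
def Hull.translate {T : Set (Tile d L)} (hT : IsTiling T) (w : Euc d) : Hull T :=
  ⟨move (transl (-w)) T, hT.move _, fun P hP _ => ⟨w, by
    simpa only [transl_neg, move_move_inv] using move_mono (transl w) hP⟩⟩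

theorem Hull.ext_iff {T : Set (Tile d L)} {T₁ T₂ : Hull T} : T₁ = T₂ ↔ T₁.1 = T₂.1 :=
  Subtype.ext_iff

theorem Hull.val_translate {T : Set (Tile d L)} (hT : IsTiling T) (w : Euc d) :
    (Hull.translate hT w).1 = move (transl (-w)) T := rfl

theorem Hull.translate_zero {T : Set (Tile d L)} (hT : IsTiling T) :
    Hull.translate hT 0 = Hull.base hT :=
  Subtype.ext (by simp only [Hull.translate, Hull.base, neg_zero, transl_zero, move_one])

/-- A compactness argument. Modulo `Λ`, only finitely many translations carry a fixed tile `t₀` of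
`T'` into `T`. If none of them carried all of `T'` into `T`, then `t₀` together with one offending
tile for each would be a finite patch not appearing in `T`. -/
theorem Hull.translate_surjective {T : Set (Tile d L)} (hT : IsTiling T) (hper : IsPeriodic T) :
    Function.Surjective (Hull.translate hT) := by
  rintro ⟨T', hT', hli⟩
  obtain ⟨t₀, ht₀⟩ := hT'.nonempty
  obtain ⟨R, hR⟩ := hper.exists_norm_sub_le
  have hfin := hT.finite_translates (hT'.polyhedral t₀ ht₀) R
  suffices ∃ w : Euc d, move (transl w) T' ⊆ T by
    obtain ⟨w, hw⟩ := this
    refine ⟨w, Subtype.ext ?_⟩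
    simp only [Hull.translate]
    rw [← (hT'.move _).eq_of_subset hT hw, transl_neg, move_inv_move]
  by_contra! hcon
  have hex : ∀ w : Euc d, ∃ t ∈ T', t.move (transl w) ∉ T := fun w => by
    obtain ⟨_, ⟨t, ht, rfl⟩, hn⟩ := Set.not_subset.1 (hcon w)
    exact ⟨t, ht, hn⟩
  choose f hfT' hfT using hex
  obtain ⟨v, hv⟩ := hli (insert t₀ (f '' _))
    (Set.insert_subset ht₀ (Set.image_subset_iff.2 fun w _ => hfT' w)) ((hfin.image f).insert t₀)
  -- Adjusting `v` by a symmetry of `T` brings it into the finite set of candidates.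
  obtain ⟨l, hl, hvl⟩ := hR v
  have hmem : ∀ t : Tile d L, t.move (transl v) ∈ T → t.move (transl (v - l)) ∈ T := by
    intro t ht
    rw [sub_eq_neg_add, transl_add, Tile.move_mul, ← mem_translations.1 (neg_mem hl)]
    exact ⟨_, ht, rfl⟩
  refine hfT (v - l) (hmem _ (hv ⟨_, Set.mem_insert_of_mem _ ⟨v - l, ⟨hmem _ ?_, hvl⟩, rfl⟩, rfl⟩))
  exact hv ⟨_, Set.mem_insert _ _, rfl⟩

theorem Hull.translate_eq_iff {T : Set (Tile d L)} (hT : IsTiling T) {v w : Euc d} :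
    Hull.translate hT v = Hull.translate hT w ↔ v - w ∈ translations T := by
  rw [Hull.ext_iff, mem_translations, sub_eq_add_neg, transl_add, move_mul, Hull.val_translate,
    Hull.val_translate]
  constructor <;> intro h
  · rw [← h, transl_neg, move_move_inv]
  · rw [← move_inv_move (transl v) (move (transl (-w)) T), h, transl_neg]

/-! ### Symmetries and the point group -/

theorem ballPatch_move (Φ : Isom d) (P : Set (Tile d L)) (x : Euc d) (r : ℝ) :
    ballPatch (move Φ P) (Φ x) r = move Φ (ballPatch P x r) := by
  have hb : Metric.closedBall (Φ x) r = Φ '' Metric.closedBall x r :=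
    (Φ.toIsometryEquiv.image_closedBall x r).symm
  ext t
  constructor
  · rintro ⟨⟨s, hs, rfl⟩, h⟩
    rw [Tile.move_carrier, hb, ← Set.image_inter Φ.injective] at h
    exact ⟨s, ⟨hs, h.of_image⟩, rfl⟩
  · rintro ⟨s, ⟨hs, h⟩, rfl⟩
    refine ⟨⟨s, hs, rfl⟩, ?_⟩
    rw [Tile.move_carrier, hb, ← Set.image_inter Φ.injective]
    exact h.image _

theorem ballPatch_mono (T : Set (Tile d L)) (x : Euc d) {r s : ℝ} (h : r ≤ s) :
    ballPatch T x r ⊆ ballPatch T x s := fun _ ht =>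
  ⟨ht.1, ht.2.mono (Set.inter_subset_inter_right _ (Metric.closedBall_subset_closedBall h))⟩

theorem ballPatch_subset (T : Set (Tile d L)) (x : Euc d) (r : ℝ) : ballPatch T x r ⊆ T :=
  fun _ ht => ht.1

theorem AppearsIn.of_move_subset {P T : Set (Tile d L)} {Φ : Isom d} (h : move Φ P ⊆ T) :
    AppearsIn (move (rot (linearPart d Φ)) P) T :=
  ⟨Φ 0, by rwa [← move_mul, ← isom_eq_transl_mul_rot]⟩

variable {T : Set (Tile d L)} {G : Subgroup (Euc d ≃ₗᵢ[ℝ] Euc d)}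

theorem HasPointGroup.linearPart_mem (hG : HasPointGroup T G) {Φ : Isom d}
    (hΦ : Φ ∈ posSpaceGroup T) : linearPart d Φ ∈ G := by
  obtain ⟨r, -, h⟩ := hG.maximal
  refine h 0 _ hΦ.1 (.of_move_subset ?_)
  exact (move_mono Φ (ballPatch_subset T 0 r)).trans hΦ.2.subset

/-- The homomorphism from the positive space group to the point group given by the linear part. -/
def HasPointGroup.linearPart (hG : HasPointGroup T G) : posSpaceGroup T →* G :=
  ((RotTiling.linearPart d).comp (posSpaceGroup T).subtype).codRestrict G
    fun Φ => hG.linearPart_mem Φ.2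

/-- All patches of `g(T)` appear in `T`, so `g(T)` lies in the hull and is a translate of `T`;
undoing that translation gives a symmetry with linear part `g`. -/
theorem HasPointGroup.linearPart_surjective (hG : HasPointGroup T G) (hT : IsTiling T)
    (hper : IsPeriodic T) : Function.Surjective hG.linearPart := by
  rintro ⟨g, hg⟩
  have hli : LocallyIndistinguishable T (move (rot g) T) := by
    intro P hP hfin
    rw [← move_move_inv (rot g) P]
    refine hG.acts.appears g hg _ ?_ (hfin.image _)
    rw [← move_inv_move (rot g) T]
    exact move_mono _ hP
  obtain ⟨w, hw⟩ := Hull.translate_surjective hT hper ⟨move (rot g) T, hT.move _, hli⟩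
  have hw' : move (transl (-w)) T = move (rot g) T := congrArg Subtype.val hw
  have hlin : RotTiling.linearPart d (transl w * rot g) = g := by
    rw [map_mul, linearPart_transl, linearPart_rot, one_mul]
  refine ⟨⟨transl w * rot g, by rw [hlin]; exact hG.acts.le_SO hg, ?_⟩, Subtype.ext hlin⟩
  rw [move_mul, ← hw', transl_neg, move_move_inv]

/-- A translational symmetry, as an element of the positive space group. -/
def translationHom (T : Set (Tile d L)) : Multiplicative (translations T) →* posSpaceGroup T where
  toFun w := ⟨transl (w.toAdd : Euc d), by
    rw [linearPart_transl]; exact one_mem _, w.toAdd.2⟩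
  map_one' := Subtype.ext transl_zero
  map_mul' _ _ := Subtype.ext (transl_add _ _)

theorem coe_translationHom (w : Multiplicative (translations T)) :
    (translationHom T w : Isom d) = transl (w.toAdd : Euc d) := rfl

theorem translationHom_injective : Function.Injective (translationHom T) := by
  intro v w h
  have h0 : (transl (v.toAdd : Euc d) : Isom d) 0 = transl (w.toAdd : Euc d) 0 := by
    rw [← coe_translationHom, h, coe_translationHom]
  have h1 : (v.toAdd : Euc d) = w.toAdd := by simpa using h0
  exact Multiplicative.toAdd.injective (Subtype.ext h1)

theorem HasPointGroup.range_translationHom (hG : HasPointGroup T G) :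
    (translationHom T).range = hG.linearPart.ker := by
  ext Φ
  rw [MonoidHom.mem_range, MonoidHom.mem_ker]
  constructor
  · rintro ⟨w, rfl⟩
    exact Subtype.ext (linearPart_transl _)
  · intro h
    have h1 : RotTiling.linearPart d Φ = 1 := congrArg Subtype.val h
    have h2 : transl ((Φ : Isom d) 0) = (Φ : Isom d) := by
      conv_rhs => rw [isom_eq_transl_mul_rot (Φ : Isom d), h1]
      exact (mul_one _).symm
    refine ⟨Multiplicative.ofAdd ⟨(Φ : Isom d) 0, ?_⟩, Subtype.ext h2⟩
    rw [mem_translations, h2]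
    exact Φ.2.2

/-- The standard extension of the positive space group. -/
def HasPointGroup.standardExtension (hG : HasPointGroup T G) (hT : IsTiling T)
    (hper : IsPeriodic T) :
    GroupExtension (Multiplicative (translations T)) (posSpaceGroup T) G where
  inl := translationHom T
  rightHom := hG.linearPart
  inl_injective := translationHom_injective
  range_inl_eq_ker_rightHom := hG.range_translationHom
  rightHom_surjective := hG.linearPart_surjective hT hper

/-! ### The topology of the hull -/

/-- The finitely many nontrivial elements of `G` stay at a positive distance from the identity. -/
theorem ActsByRotations.eventually_eq_one (hG : ActsByRotations T G) :
    ∀ᶠ ε : ℝ in 𝓝[>] 0, ∀ g ∈ G, ‖(g.toContinuousLinearEquiv : Euc d →L[ℝ] Euc d) -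
      ContinuousLinearMap.id ℝ (Euc d)‖ < ε → g = 1 := by
  have := hG.finite
  suffices ∀ᶠ ε : ℝ in 𝓝[>] 0, ∀ g : G,
      ‖((g : Euc d ≃ₗᵢ[ℝ] Euc d).toContinuousLinearEquiv : Euc d →L[ℝ] Euc d) -
        ContinuousLinearMap.id ℝ (Euc d)‖ < ε → (g : Euc d ≃ₗᵢ[ℝ] Euc d) = 1 by
    filter_upwards [this] with ε h g hg
    exact h ⟨g, hg⟩
  rw [eventually_all]
  intro g
  by_cases h1 : (g : Euc d ≃ₗᵢ[ℝ] Euc d) = 1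
  · exact Eventually.of_forall fun _ _ => h1
  · have hpos : 0 < ‖((g : Euc d ≃ₗᵢ[ℝ] Euc d).toContinuousLinearEquiv : Euc d →L[ℝ] Euc d) -
        ContinuousLinearMap.id ℝ (Euc d)‖ := by
      refine norm_pos_iff.2 fun h => h1 ?_
      ext1 x
      exact DFunLike.congr_fun (sub_eq_zero.1 h) x
    filter_upwards [Ioo_mem_nhdsGT hpos] with ε hε h
    exact absurd h hε.2.not_gt

/-- At small scales, two tilings of the hull of a periodic tiling are close only if they differ
by a small translation. -/
theorem HasPointGroup.eventually_isClose (hG : HasPointGroup T G) (hT : IsTiling T)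
    (hper : IsPeriodic T) : ∀ᶠ ε : ℝ in 𝓝[>] 0, ∀ a b : Euc d,
      IsClose ε (Hull.translate hT a).1 (Hull.translate hT b).1 →
        ∃ w : Euc d, ‖w - a‖ < ε ∧ Hull.translate hT w = Hull.translate hT b := by
  obtain ⟨r, -, hr⟩ := hG.maximal
  obtain ⟨R, hR⟩ := hper.exists_norm_sub_le
  -- Three demands on the scale: elements of `G` within `ε` of the identity are trivial, the ball of
  -- radius `ε⁻¹` contains a patch large enough to detect `G`, and it meets every coset of `Λ`.
  filter_upwards [hG.acts.eventually_eq_one, tendsto_inv_nhdsGT_zero.eventually_ge_atTop r,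
    tendsto_inv_nhdsGT_zero.eventually_ge_atTop R] with ε hε hrε hRε a b hab
  obtain ⟨w, g, hg, hw, hgε, hp⟩ := hab
  rw [Hull.val_translate, Hull.val_translate] at hp
  have hp' : ballPatch (move (rot g * transl (w - a)) T) 0 ε⁻¹ =
      ballPatch (move (transl (-b)) T) 0 ε⁻¹ := by
    rw [← hp, sub_eq_add_neg, transl_add, move_mul, move_mul]
  have hgG : g ∈ G := by
    -- This isometry has linear part `g` and carries the `r`-patch of `T` at `a - w` into `T`, so
    -- maximality of `G` applies to `g`.
    have hΨ : (transl b * (rot g * transl (w - a)) : Isom d) (a - w) = b := by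
      change b + g ((w - a) + (a - w)) = b
      rw [sub_add_sub_cancel, sub_self, map_zero, add_zero]
    have hΨ' : (rot g * transl (w - a) : Isom d) (a - w) = 0 := by
      change g ((w - a) + (a - w)) = 0
      rw [sub_add_sub_cancel, sub_self, map_zero]
    have key : AppearsIn (move (rot (RotTiling.linearPart d (transl b * (rot g * transl (w - a)))))
        (ballPatch T (a - w) r)) T := by
      refine .of_move_subset ?_
      rw [move_mul, ← ballPatch_move, hΨ']
      calc _ ⊆ move (transl b) (ballPatch (move (rot g * transl (w - a)) T) 0 ε⁻¹) :=
            move_mono _ (ballPatch_mono _ _ hrε)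
        _ ⊆ move (transl b) (move (transl (-b)) T) := by
            rw [hp']
            exact move_mono _ (ballPatch_subset _ _ _)
        _ = T := by rw [transl_neg, move_move_inv]
    rw [map_mul, map_mul, linearPart_transl, linearPart_transl, linearPart_rot, one_mul,
      mul_one] at key
    exact hr _ g hg key
  obtain rfl : g = 1 := hε g hgG hgε
  have hone : (rot 1 : Isom d) * transl (w - a) = transl (w - a) := one_mul _
  rw [hone] at hp'
  refine ⟨a - w, by rwa [sub_sub_cancel_left, norm_neg], Subtype.ext ?_⟩
  refine (hT.move _).eq_of_subset (hT.move _) fun t ht => ?_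
  rw [neg_sub] at ht
  have hinv : ∀ v l : Euc d, l ∈ translations T →
      move (transl l) (move (transl v) T) = move (transl v) T := by
    intro v l hl
    rw [← move_mul, ← transl_add, add_comm, transl_add, move_mul, mem_translations.1 hl]
  obtain ⟨x, hx⟩ := ((hT.move _).polyhedral t ht).interior_nonempty.mono interior_subset
  -- A symmetry of both tilings moves `t` to a tile meeting the ball on which they agree; moving
  -- back puts `t` in the other tiling.
  obtain ⟨l, hl, hxl⟩ := hR x
  have hmem : t.move (transl (-l)) ∈ ballPatch (move (transl (w - a)) T) 0 ε⁻¹ := by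
    refine ⟨?_, x - l, ⟨x, hx, ?_⟩, ?_⟩
    · rw [← hinv _ _ (neg_mem hl)]
      exact ⟨t, ht, rfl⟩
    · exact neg_add_eq_sub l x
    · exact mem_closedBall_zero_iff.2 (hxl.trans hRε)
  rw [hp'] at hmem
  have : (t.move (transl (-l))).move (transl l) ∈ move (transl l) (move (transl (-b)) T) :=
    ⟨_, hmem.1, rfl⟩
  rw [← Tile.move_mul, ← transl_add, add_neg_cancel, transl_zero, Tile.move_one] at this
  rwa [hinv _ _ hl] at this

theorem Hull.isClose_translate (hT : IsTiling T) {ε : ℝ} (hε : 0 < ε) {a b : Euc d}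
    (h : ‖a - b‖ < ε) : IsClose ε (Hull.translate hT a).1 (Hull.translate hT b).1 := by
  refine ⟨a - b, 1, one_mem _, h, ?_, ?_⟩
  · have : (((1 : Euc d ≃ₗᵢ[ℝ] Euc d).toContinuousLinearEquiv : Euc d →L[ℝ] Euc d) -
        ContinuousLinearMap.id ℝ (Euc d)) = 0 := sub_self _
    rwa [this, norm_zero]
  · have : (rot 1 : Isom d) = 1 := rfl
    simp only [Hull.translate]
    have h' : a - b + -a = -b := by abel
    rw [this, move_one, ← move_mul, ← transl_add, h']

theorem Hull.isQuotientMap_translate (hT : IsTiling T) (hper : IsPeriodic T)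
    (hG : HasPointGroup T G) : IsQuotientMap (Hull.translate hT) := by
  refine (isQuotientMap_iff _).2 ⟨.of_isOpen_preimage_iff_isOpen fun U => ⟨?_, fun hU => ?_⟩,
    Hull.translate_surjective hT hper⟩
  · intro hU T₁ hT₁
    obtain ⟨a, rfl⟩ := Hull.translate_surjective hT hper T₁
    obtain ⟨δ, hδ, h⟩ := Metric.isOpen_iff.1 hU a hT₁
    obtain ⟨ε, hε, hεδ⟩ := ((hG.eventually_isClose hT hper).and (Ioo_mem_nhdsGT hδ)).exists
    refine ⟨ε, hεδ.1, fun T₂ hc => ?_⟩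
    obtain ⟨b, rfl⟩ := Hull.translate_surjective hT hper T₂
    obtain ⟨w, hw, hwb⟩ := hε a b hc
    rw [← hwb]
    exact h (by rw [Metric.mem_ball, dist_eq_norm]; exact hw.trans hεδ.2)
  · refine Metric.isOpen_iff.2 fun a ha => ?_
    obtain ⟨ε, hε, h⟩ := hU _ ha
    refine ⟨ε, hε, fun b hb => h _ (Hull.isClose_translate hT hε ?_)⟩
    rwa [← dist_eq_norm, dist_comm]

/-! ### Naturality of the deck group homomorphism -/

/-- `F` carries a lift of `γ` to a lift of its image under `f`, and lifts with a given starting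
point are unique. -/
theorem monodromy_map_eq {E E' X X' : Type*} [TopologicalSpace E] [TopologicalSpace E']
    [TopologicalSpace X] [TopologicalSpace X'] {p : E → X} {p' : E' → X'}
    (hp : IsCoveringMap p) (hp' : IsCoveringMap p') (F : C(E, E')) (f : C(X, X'))
    (hf : ∀ e, f (p e) = p' (F e)) {x y : X} (γ : Path.Homotopic.Quotient x y) (e : p ⁻¹' {x})
    (e' : p' ⁻¹' {f x}) (he : F e.1 = e'.1) :
    (hp'.monodromy (γ.map f) e').1 = F (hp.monodromy γ e).1 := by
  obtain ⟨γ⟩ := γ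
  have h0 : γ 0 = p e.1 := γ.source.trans e.2.symm
  have key : F ∘ hp.liftPath γ e.1 h0 = hp'.liftPath (γ.map f.continuous) e'.1
      ((γ.map f.continuous).source.trans e'.2.symm) := by
    refine (hp'.eq_liftPath_iff _).2 ⟨F.continuous.comp (ContinuousMap.continuous _), ?_, ?_⟩
    · ext t
      rw [Function.comp_apply, Function.comp_apply, ← hf]
      exact congrArg f (congrFun (hp.liftPath_lifts γ e.1 h0) t)
    · rw [Function.comp_apply, hp.liftPath_zero, he]
  exact (congrFun key 1).symm

/-- The homomorphism from the fundamental group of the base of a quotient covering map to the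
opposite of its group is natural with respect to equivariant maps. -/
theorem unop_fundamentalGroupToMulOpposite_map {E E' X X' H H' : Type*} [TopologicalSpace E]
    [TopologicalSpace E'] [TopologicalSpace X] [TopologicalSpace X'] [Group H] [Group H']
    [MulAction H E] [MulAction H' E'] {p : E → X} {p' : E' → X'}
    (hp : IsQuotientCoveringMap p H) (hp' : IsQuotientCoveringMap p' H') (F : C(E, E'))
    (φ : H →* H') (hF : ∀ h e, F (h • e) = φ h • F e) (f : C(X, X'))
    (hf : ∀ e, f (p e) = p' (F e)) {x : X} (e : p ⁻¹' {x}) (e' : p' ⁻¹' {f x})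
    (he : F e.1 = e'.1) (γ : FundamentalGroup X x) :
    (hp'.fundamentalGroupToMulOpposite e' (FundamentalGroup.map f x γ)).unop =
      φ (hp.fundamentalGroupToMulOpposite e γ).unop := by
  rw [← MulOpposite.unop_op (φ _)]
  refine congrArg MulOpposite.unop (hp'.fundamentalGroupToMulOpposite_apply_eq_Iff.2 ?_)
  rw [MulOpposite.unop_op, ← he, ← hF, hp.unop_fundamentalGroupToMulOpposite_smul]
  exact (monodromy_map_eq hp.isCoveringMap hp'.isCoveringMap F f hf γ e e' he).symm

/-! ### The coverings of the hull and of the Borel construction -/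

theorem multiplicative_translations_smul_def (l : Multiplicative (translations T)) (x : Euc d) :
    l • x = (l.toAdd : Euc d) + x := rfl

theorem Hull.isQuotientCoveringMap_translate (hT : IsTiling T) (hper : IsPeriodic T)
    (hG : HasPointGroup T G) :
    IsQuotientCoveringMap (Hull.translate hT) (Multiplicative (translations T)) where
  toIsQuotientMap := Hull.isQuotientMap_translate hT hper hG
  continuous_const_smul l := by
    simp only [multiplicative_translations_smul_def]
    fun_prop
  apply_eq_iff_mem_orbit {v w} := by
    rw [Hull.translate_eq_iff]
    constructor
    · intro h
      exact ⟨Multiplicative.ofAdd ⟨v - w, h⟩, sub_add_cancel v w⟩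
    · rintro ⟨l, rfl⟩
      have : l • w - w = l.toAdd := add_sub_cancel_right _ _
      exact this ▸ l.toAdd.2
  disjoint x := by
    obtain ⟨δ, hδ, h⟩ := hT.exists_pos_le_norm
    refine ⟨Metric.ball x (δ / 2), Metric.ball_mem_nhds x (half_pos hδ), ?_⟩
    rintro l ⟨_, ⟨y, hy, rfl⟩, hly⟩
    refine Multiplicative.toAdd.injective (Subtype.ext (h _ l.toAdd.2 ?_))
    have h1 : (l.toAdd : Euc d) = l • y - y := (add_sub_cancel_right _ _).symm
    rw [h1, ← dist_eq_norm]
    linarith [dist_triangle_right (l • y) y x, Metric.mem_ball.1 hy, Metric.mem_ball.1 hly]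

variable {EG : Type v} [MulAction G EG]

/-- The diagonal action of the positive space group on `ℝ^d × EG`. -/
abbrev HasPointGroup.action (hG : HasPointGroup T G) (EG : Type v) [MulAction G EG] :
    MulAction (posSpaceGroup T) (Euc d × EG) where
  smul Φ a := ((Φ : Isom d) a.1, hG.linearPart Φ • a.2)
  one_smul a := Prod.ext rfl (by
    change hG.linearPart 1 • a.2 = a.2
    rw [map_one, one_smul])
  mul_smul Φ Ψ a := Prod.ext rfl (by
    change hG.linearPart (Φ * Ψ) • a.2 = hG.linearPart Φ • hG.linearPart Ψ • a.2
    rw [map_mul, mul_smul])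

/-- The map `ℝ^d × EG → Ω_G`, `(w, e) ↦ [T - w, e]`. -/
def BorelHull.translate (hT : IsTiling T) (G : Subgroup (Euc d ≃ₗᵢ[ℝ] Euc d)) {EG : Type v}
    [MulAction G EG] (a : Euc d × EG) : BorelHull T G EG :=
  Quotient.mk _ (Hull.translate hT a.1, a.2)

theorem move_isom_transl_neg {Φ : Isom d} (h : move Φ T = T) (w : Euc d) :
    move (rot (linearPart d Φ)) (move (transl (-w)) T) = move (transl (-(Φ w))) T := by
  conv_rhs => rw [← h, ← move_mul]
  rw [← move_mul]
  congr 1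
  ext1 x
  change Φ.linearIsometryEquiv (-w + x) = -Φ w + Φ x
  rw [neg_add_eq_sub, neg_add_eq_sub]
  exact Φ.map_vsub x w

theorem BorelHull.translate_eq_iff (hT : IsTiling T) (hG : HasPointGroup T G)
    {a b : Euc d × EG} : BorelHull.translate hT G a = BorelHull.translate hT G b ↔
      ∃ Φ : posSpaceGroup T, (Φ : Isom d) b.1 = a.1 ∧ hG.linearPart Φ • b.2 = a.2 := by
  rw [eq_comm, BorelHull.translate, BorelHull.translate, Quotient.eq]
  constructor
  · rintro ⟨g, h1, h2⟩
    -- The symmetry sought is `x ↦ a.1 + g (x - b.1)`; it preserves `T` because `g (T - b.1) = T -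
    -- a.1`.
    have hlin : linearPart d (transl a.1 * rot g.1 * transl (-b.1)) = g.1 := by
      rw [map_mul, map_mul, linearPart_transl, linearPart_transl, linearPart_rot, one_mul,
        mul_one]
    have h1' : move (rot g.1) (move (transl (-b.1)) T) = move (transl (-a.1)) T := h1
    have hmem : transl a.1 * rot g.1 * transl (-b.1) ∈ posSpaceGroup T := by
      refine ⟨by rw [hlin]; exact hG.acts.le_SO g.2, ?_⟩
      rw [move_mul, move_mul, h1', transl_neg, move_move_inv]
    refine ⟨⟨_, hmem⟩, ?_, ?_⟩
    · change a.1 + g.1 (-b.1 + b.1) = a.1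
      rw [neg_add_cancel, map_zero, add_zero]
    · have : hG.linearPart ⟨_, hmem⟩ = g := Subtype.ext hlin
      rw [this]
      exact h2
  · rintro ⟨Φ, h1, h2⟩
    refine ⟨hG.linearPart Φ, ?_, h2⟩
    change move _ (move (transl (-b.1)) T) = move (transl (-a.1)) T
    rw [← h1]
    exact move_isom_transl_neg Φ.2.2 b.1

theorem BorelHull.isQuotientCoveringMap_translate [TopologicalSpace EG] (hT : IsTiling T) (hper : IsPeriodic T)
    (hG : HasPointGroup T G) (hEG : IsUniversalSpace G EG) :
    letI := hG.action EG
    IsQuotientCoveringMap (BorelHull.translate (EG := EG) hT G) (posSpaceGroup T) := by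
  let _ := hG.action EG
  have hcov := Hull.isQuotientCoveringMap_translate hT hper hG
  exact
  { toIsQuotientMap := by
      -- Openness of the covering is essential: a product of quotient maps need not be a quotient
      -- map.
      have : IsOpenQuotientMap (Prod.map (Hull.translate hT) (id : EG → EG)) :=
        IsOpenQuotientMap.prodMap ⟨hcov.surjective, hcov.continuous,
          hcov.isCoveringMap.isOpenMap⟩ .id
      exact isQuotientMap_quotient_mk'.comp this.isQuotientMap
    continuous_const_smul := fun Φ =>
      ((Φ : Isom d).continuous.comp continuous_fst).prodMk
        ((hEG.continuous_smul _).comp continuous_snd)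
    apply_eq_iff_mem_orbit := by
      intro a b
      rw [BorelHull.translate_eq_iff hT hG]
      exact exists_congr fun Φ => (Prod.ext_iff (x := Φ • b) (y := a)).symm
    disjoint := by
      rintro ⟨x, e⟩
      obtain ⟨U, hU, hU'⟩ := hcov.disjoint x
      obtain ⟨V, hV, hV'⟩ := hEG.free e
      refine ⟨U ×ˢ V, prod_mem_nhds hU hV, ?_⟩
      rintro Φ ⟨_, ⟨⟨y, f⟩, ⟨hy, hf⟩, rfl⟩, hΦy, hΦf⟩
      -- Freeness on `EG` makes `Φ` a translation; freeness of `Λ` on `ℝ^d` then makes it trivial.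
      have h1 : hG.linearPart Φ = 1 := hV' _ ⟨_, ⟨f, hf, rfl⟩, hΦf⟩
      obtain ⟨l, rfl⟩ := hG.range_translationHom.ge h1
      have h2 : l = 1 := hU' l ⟨_, ⟨y, hy, rfl⟩, hΦy⟩
      rw [h2, map_one] }

/-! ### Comparison of the extensions -/

/-- The group extension obtained from another one by replacing the normal subgroup and the total
group by isomorphic groups. -/
def groupExtensionOfEquiv {N N' E E' H : Type*} [Group N] [Group N'] [Group E] [Group E'] [Group H]
    (S : GroupExtension N' E' H) (inl : N →* E) (rightHom : E →* H) (ψ : N ≃* N') (φ : E ≃* E')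
    (hinl : ∀ a, φ (inl a) = S.inl (ψ a)) (hright : ∀ b, S.rightHom (φ b) = rightHom b) :
    GroupExtension N E H where
  inl := inl
  rightHom := rightHom
  inl_injective a b h := ψ.injective (S.inl_injective (by rw [← hinl, ← hinl, h]))
  range_inl_eq_ker_rightHom := by
    ext b
    rw [MonoidHom.mem_ker, ← hright, ← MonoidHom.mem_ker, ← S.range_inl_eq_ker_rightHom,
      MonoidHom.mem_range, MonoidHom.mem_range,
      ψ.surjective.exists (p := fun x => S.inl x = φ b)]
    simp only [← hinl, φ.injective.eq_iff]
  rightHom_surjective h := by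
    obtain ⟨b', rfl⟩ := S.rightHom_surjective h
    obtain ⟨b, rfl⟩ := φ.surjective b'
    exact ⟨b, (hright b).symm⟩

/-- The isomorphism from the fundamental group of the base of a simply connected quotient covering
map to its group. A loop whose lift ends at `h • e` is sent to `h⁻¹`. -/
def deckEquiv {E X H : Type*} [TopologicalSpace E] [TopologicalSpace X] [Group H] [MulAction H E]
    [SimplyConnectedSpace E] {p : E → X} (hp : IsQuotientCoveringMap p H) {x : X}
    (e : p ⁻¹' {x}) : FundamentalGroup X x ≃* H :=
  (hp.fundamentalGroupEquiv e).trans (MulEquiv.inv' H).symm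

theorem deckEquiv_apply {E X H : Type*} [TopologicalSpace E] [TopologicalSpace X] [Group H]
    [MulAction H E] [SimplyConnectedSpace E] {p : E → X} (hp : IsQuotientCoveringMap p H) {x : X}
    (e : p ⁻¹' {x}) (γ : FundamentalGroup X x) :
    deckEquiv hp e γ = (hp.fundamentalGroupToMulOpposite e γ).unop⁻¹ := rfl

theorem deckEquiv_map {E E' X X' H H' : Type*} [TopologicalSpace E]
    [TopologicalSpace E'] [TopologicalSpace X] [TopologicalSpace X'] [Group H] [Group H']
    [MulAction H E] [MulAction H' E'] [SimplyConnectedSpace E] [SimplyConnectedSpace E']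
    {p : E → X} {p' : E' → X'}
    (hp : IsQuotientCoveringMap p H) (hp' : IsQuotientCoveringMap p' H') (F : C(E, E'))
    (φ : H →* H') (hF : ∀ h e, F (h • e) = φ h • F e) (f : C(X, X'))
    (hf : ∀ e, f (p e) = p' (F e)) {x : X} (e : p ⁻¹' {x}) (e' : p' ⁻¹' {f x})
    (he : F e.1 = e'.1) (γ : FundamentalGroup X x) :
    deckEquiv hp' e' (FundamentalGroup.map f x γ) = φ (deckEquiv hp e γ) := by
  rw [deckEquiv_apply, deckEquiv_apply, map_inv,
    unop_fundamentalGroupToMulOpposite_map hp hp' F φ hF f hf e e' he γ]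

end RotTiling
end

open RotTiling

theorem mainTheorem1 {d : ℕ} (hd : 2 ≤ d) {L : Type*} (T : Set (Tile d L)) (hT : IsTiling T)
    (hper : IsPeriodic T) (G : Subgroup (Euc d ≃ₗᵢ[ℝ] Euc d)) (hG : HasPointGroup T G)
    {EG : Type*} [TopologicalSpace EG] [MulAction G EG] (hEG : IsUniversalSpace G EG) (e₀ : EG) :
    -- the translational symmetries form a group isomorphic to `ℤ^d`
    Nonempty (translations T ≃+ (Fin d → ℤ)) ∧
    -- `S` is the extension `π₁(Ω_t) → π₁(Ω_G) → G`, and `S'` is the standard extension of `Γ₊`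
    ∃ (S : GroupExtension (FundamentalGroup (Hull T) (Hull.base hT))
          (FundamentalGroup (BorelHull T G EG) (fibreInclusion T G e₀ (Hull.base hT))) G)
      (S' : GroupExtension (Multiplicative (translations T)) (posSpaceGroup T) G),
      S.inl = piInclusion hT G e₀ ∧
      S.rightHom = (piClassifyingSpace hEG e₀).toMonoidHom.comp (piProjection hT G e₀) ∧
      (∀ w, (S'.inl w : Isom d) = transl (w.toAdd : Euc d)) ∧
      (∀ Φ, (S'.rightHom Φ : Euc d ≃ₗᵢ[ℝ] Euc d) = linearPart d Φ) ∧
      -- the two extensions are isomorphic, by an isomorphism which is the identity on `G`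
      ∃ (ψ : FundamentalGroup (Hull T) (Hull.base hT) ≃* Multiplicative (translations T))
        (φ : FundamentalGroup (BorelHull T G EG) (fibreInclusion T G e₀ (Hull.base hT)) ≃*
          posSpaceGroup T),
        (∀ a, φ (S.inl a) = S'.inl (ψ a)) ∧ ∀ b, S'.rightHom (φ b) = S.rightHom b := by
  refine ⟨nonempty_translations_addEquiv hT hper, ?_⟩
  have := hEG.contractible
  let _ := hG.action EG
  have hcov := Hull.isQuotientCoveringMap_translate hT hper hG
  have hcovB := BorelHull.isQuotientCoveringMap_translate hT hper hG hEG
  let x₀ : Hull.translate hT ⁻¹' {Hull.base hT} := ⟨0, Hull.translate_zero hT⟩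
  let y₀ : BorelHull.translate hT G ⁻¹' {fibreInclusion T G e₀ (Hull.base hT)} :=
    ⟨(0, e₀), by
      change Quotient.mk _ (Hull.translate hT 0, e₀) = Quotient.mk _ (Hull.base hT, e₀)
      rw [Hull.translate_zero]⟩
  let z₀ : (ClassifyingSpace.mk G : EG → ClassifyingSpace G EG) ⁻¹'
      {borelProjection T G EG (fibreInclusion T G e₀ (Hull.base hT))} := ⟨e₀, rfl⟩
  let ψ := deckEquiv hcov x₀
  let φ := deckEquiv hcovB y₀
  let S' := hG.standardExtension hT hper
  -- The lift is `w ↦ (w, e₀)`, equivariant because translations have trivial linear part and so fix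
  -- `e₀`.
  have hinl : ∀ a, φ (piInclusion hT G e₀ a) = S'.inl (ψ a) :=
    deckEquiv_map hcov hcovB ⟨fun w => (w, e₀), by fun_prop⟩ (translationHom T)
      (fun l w => Prod.ext rfl (by
        have h1 : hG.linearPart (translationHom T l) = 1 := S'.rightHom_inl l
        change e₀ = hG.linearPart (translationHom T l) • e₀
        rw [h1, one_smul]))
      (fibreInclusion T G e₀) (fun _ => rfl) x₀ y₀ rfl
  -- The lift is the projection to `EG`, equivariant along the linear part; `piClassifyingSpace`
  -- unfolds to `deckEquiv` of `EG → BG`.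
  have hright : ∀ b, S'.rightHom (φ b) =
      (piClassifyingSpace hEG e₀).toMonoidHom.comp (piProjection hT G e₀) b := fun b =>
    (deckEquiv_map hcovB hEG.covering ⟨Prod.snd, continuous_snd⟩ hG.linearPart
      (fun _ _ => rfl) (borelProjection T G EG) (fun _ => rfl) y₀ z₀ rfl b).symm
  exact ⟨groupExtensionOfEquiv S' _ _ ψ φ hinl hright, S', rfl, rfl, fun _ => rfl, fun _ => rfl,
    ψ, φ, hinl, hright⟩
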